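/- For every integer $n\ge 2$ the polynomial $x^n-x-1$ has exactly one real root greater than $1$; denote it by $\beta_n$. For every integer $n\ge 6$, among the complex roots of $x^n-x-1$ with positive imaginary part there is exactly one whose distance to $\beta_n$ in $\mathbb{C}$ is minimal; denote it by $\gamma_n$. Then $$\left|\beta_n-\left(1+\frac{\log 2}{n}\right)\right|\le \frac{2}{3n^2}\qquad\text{for all integers } n\ge 8,$$ $$\left|\gamma_n-\left(1+\frac{\log 2+2\pi i}{n}\right)\right|\le \frac{24}{n^2}\qquad\text{for all integers } n\ge 6.$$ -/

import Mathlib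

/-- `β` is a real root of `x ^ n - x - 1` greater than `1`. -/
def IsBeta (n : ℕ) (β : ℝ) : Prop :=
  1 < β ∧ β ^ n - β - 1 = 0

/-- `z` is a complex root of `x ^ n - x - 1` in the open upper half-plane. -/
def IsUpperRoot (n : ℕ) (z : ℂ) : Prop :=
  z ^ n - z - 1 = 0 ∧ 0 < z.im

/-- `γ` is a root of `x ^ n - x - 1` with positive imaginary part, and no other such root is
closer to `β`. -/
def IsClosestUpperRoot (n : ℕ) (β : ℝ) (γ : ℂ) : Prop :=
  IsUpperRoot n γ ∧ ∀ z : ℂ, IsUpperRoot n z → ‖γ - (β : ℂ)‖ ≤ ‖z - (β : ℂ)‖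

/-! For real `x > 0` the power `x ^ n` overtakes `x + 1` once and for all, so testing one inequality
at a point locates `β` on one side of it. The lower bound uses `1 + t ≤ exp t`, the upper bound
second-order estimates of logarithms.

An upper root satisfies `n log z = log (1 + z) + 2πik`. Since `0 < arg (1 + z) < arg z`, necessarily
`k ≥ 1`. The case `k = 1` is the principal root: its logarithm is a fixed point of a contraction
(`norm_logMap_sub_le`, `mapsTo_logMap`), so it exists and is unique. All other upper roots have
argument above `4π / n`. The principal root has modulus in `[1, β]` and argument below `2π / (n -
1)`, hence it is closer to `β` than every other upper root (`isClosestUpperRoot_iff`), and `γ` is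
the principal root.

For `n ≥ 20` its distance to `1 + (log 2 + 2πi) / n` follows from polar estimates. For `6 ≤ n < 20`
an explicit Gaussian rational is certified to lie near a root, and uniqueness identifies that root
with `γ`. -/

/-! ### The real root -/

/-- Beyond a positive point where `x + 1 ≤ x ^ n`, the inequality is strict. -/
theorem add_one_lt_pow_of_lt {n : ℕ} (hn : 2 ≤ n) {x y : ℝ} (hx : 0 < x) (hxy : x < y)
    (h : x + 1 ≤ x ^ n) : y + 1 < y ^ n := by
  obtain ⟨m, rfl⟩ : ∃ m, n = m + 1 := ⟨n - 1, by omega⟩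
  have hy : 0 < y := hx.trans hxy
  have h1 : x ^ m ≤ y ^ m := by gcongr
  -- After division by the variable, `1 + 1/x` decreases while `x ^ m` does not.
  have h2 : y * (x + 1) ≤ x * y ^ (m + 1) := by
    calc y * (x + 1) ≤ y * x ^ (m + 1) := by gcongr
      _ = x * y * x ^ m := by ring
      _ ≤ x * y * y ^ m := by gcongr
      _ = x * y ^ (m + 1) := by ring
  nlinarith

theorem IsBeta.le_of_add_one_le_pow {n : ℕ} (hn : 2 ≤ n) {β y : ℝ} (hβ : IsBeta n β) (hy : 0 < y)
    (h : y + 1 ≤ y ^ n) : β ≤ y := by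
  by_contra! hlt
  linarith [add_one_lt_pow_of_lt hn hy hlt h, hβ.2]

theorem IsBeta.le_of_pow_le_add_one {n : ℕ} (hn : 2 ≤ n) {β y : ℝ} (hβ : IsBeta n β)
    (h : y ^ n ≤ y + 1) : y ≤ β := by
  by_contra! hlt
  linarith [add_one_lt_pow_of_lt hn (by linarith [hβ.1]) hlt (by linarith [hβ.2])]

theorem existsUnique_isBeta {n : ℕ} (hn : 2 ≤ n) : ∃! β : ℝ, IsBeta n β := by
  have hc : ContinuousOn (fun x : ℝ => x ^ n - x - 1) (Set.Icc 1 2) := by fun_prop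
  have h2 : (2 : ℝ) ^ 2 ≤ 2 ^ n := pow_le_pow_right₀ (by norm_num) hn
  obtain ⟨β, hβ, hβ0⟩ := intermediate_value_Icc (by norm_num) hc
    (show (0 : ℝ) ∈ Set.Icc _ _ by constructor <;> (norm_num; try linarith))
  simp only at hβ0
  have h1 : 1 < β := by
    refine lt_of_le_of_ne hβ.1 ?_
    rintro rfl
    norm_num at hβ0
  refine ⟨β, ⟨h1, hβ0⟩, fun y hy => le_antisymm ?_ ?_⟩
  · exact hy.le_of_add_one_le_pow hn (by linarith) (by linarith)
  · exact hy.le_of_pow_le_add_one hn (by linarith)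

theorem IsBeta.one_add_log_two_div_le {n : ℕ} (hn : 2 ≤ n) {β : ℝ} (hβ : IsBeta n β) :
    1 + Real.log 2 / n ≤ β := by
  have hn0 : (0 : ℝ) < n := by positivity
  have hl : 0 ≤ Real.log 2 / n := by positivity
  refine hβ.le_of_pow_le_add_one hn ?_
  calc (1 + Real.log 2 / n) ^ n ≤ Real.exp (Real.log 2 / n) ^ n := by
        gcongr; linarith [Real.add_one_le_exp (Real.log 2 / n)]
    _ = 2 := by
        rw [← Real.exp_nat_mul, mul_div_cancel₀ _ hn0.ne', Real.exp_log (by norm_num)]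
    _ ≤ _ := by linarith

theorem IsBeta.le_one_add_log_two_div_add {n : ℕ} (hn : 8 ≤ n) {β : ℝ} (hβ : IsBeta n β) :
    β ≤ 1 + Real.log 2 / n + 2 / (3 * (n : ℝ) ^ 2) := by
  have hl1 := Real.log_two_gt_d9
  have hl2 := Real.log_two_lt_d9
  have small : ∀ q : ℝ, 0 < q → q + 1 ≤ q ^ n → q ≤ 1 + 0.693147 / n + 2 / (3 * (n : ℝ) ^ 2) →
      β ≤ 1 + Real.log 2 / n + 2 / (3 * (n : ℝ) ^ 2) := by
    intro q hq0 hq hq'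
    refine (hβ.le_of_add_one_le_pow (by omega) hq0 hq).trans (hq'.trans ?_)
    gcongr
    linarith
  -- The general argument needs `u ^ 2 + u ≤ 4/3`, i.e. `u` at most about 0.7583, which for `u = log
  -- 2 + 2/(3n)` holds only from 11 on. Below that, rationals just under the bound serve as
  -- witnesses.
  by_cases h11 : n < 11
  · interval_cases n
    · exact small 1.09705 (by norm_num) (by norm_num) (by norm_num)
    · exact small 1.0852 (by norm_num) (by norm_num) (by norm_num)
    · exact small 1.0759 (by norm_num) (by norm_num) (by norm_num)
  have hnR : (11 : ℝ) ≤ n := by exact_mod_cast not_lt.1 h11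
  have hn0 : (0 : ℝ) < n := by linarith
  set u : ℝ := Real.log 2 + 2 / (3 * n) with hu
  have hinv : 2 / (3 * (n : ℝ)) ≤ 2 / (3 * 11) := by gcongr
  have hinv0 : 0 < 2 / (3 * (n : ℝ)) := by positivity
  have hu0 : 0 < u := by linarith
  have hu1 : u ≤ 0.7583 := by norm_num at hinv; linarith
  have hx : 1 + Real.log 2 / n + 2 / (3 * (n : ℝ) ^ 2) = 1 + u / n := by
    rw [hu]; field_simp; ring
  rw [hx]
  have hun : 0 < u / n := by positivity
  refine hβ.le_of_add_one_le_pow (by omega) (by positivity) ?_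
  have h1 : u / n - (u / n) ^ 2 / 2 ≤ Real.log (1 + u / n) := by
    have := Real.le_log_one_add_of_nonneg hun.le
    refine le_trans ?_ this
    rw [le_div_iff₀ (by positivity)]
    nlinarith [pow_pos hun 3]
  have h2 : Real.log (1 + u / n + 1) ≤ Real.log 2 + u / n / 2 := by
    have := Real.log_le_sub_one_of_pos (show 0 < 1 + u / n / 2 by positivity)
    rw [show 1 + u / n + 1 = 2 * (1 + u / n / 2) by ring, Real.log_mul (by norm_num) (by positivity)]
    linarith
  rw [← Real.log_le_log_iff (by positivity) (by positivity), Real.log_pow]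
  refine h2.trans (le_trans ?_ (mul_le_mul_of_nonneg_left h1 hn0.le))
  have h3 : n * (u / n - (u / n) ^ 2 / 2) - (Real.log 2 + u / n / 2)
      = (4 / 3 - u ^ 2 - u) / (2 * n) := by
    rw [hu]; field_simp; ring
  have h4 : 0 ≤ (4 / 3 - u ^ 2 - u) / (2 * n) := by
    apply div_nonneg _ (by positivity)
    nlinarith
  linarith


/-! ### Arguments and moduli of the upper roots -/

theorem arg_pos_of_im_pos {z : ℂ} (hz : 0 < z.im) : 0 < z.arg ∧ z.arg < Real.pi := by
  refine ⟨lt_of_le_of_ne (Complex.arg_nonneg_iff.2 hz.le) fun h => ?_, Complex.arg_lt_pi_iff.2 (.inr hz.ne')⟩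
  have := Complex.arg_eq_zero_iff.1 h.symm
  linarith [this.2]

/-- The imaginary part of `(1 + z) * conj z` is `-z.im < 0`, and it has the sign of `sin (arg (1 +
z) - arg z)`. -/
theorem arg_one_add_lt_arg {z : ℂ} (hz : 0 < z.im) : (1 + z).arg < z.arg := by
  have hz' : 0 < (1 + z).im := by simpa using hz
  obtain ⟨h1, h2⟩ := arg_pos_of_im_pos hz
  obtain ⟨h3, h4⟩ := arg_pos_of_im_pos hz'
  by_contra! hle
  have h5 := Real.sin_nonneg_of_nonneg_of_le_pi (x := (1 + z).arg - z.arg) (by linarith) (by linarith)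
  rw [Real.sin_sub] at h5
  have h6 : 0 ≤ ‖1 + z‖ * ‖z‖ * (Real.sin (1 + z).arg * Real.cos z.arg -
    Real.cos (1 + z).arg * Real.sin z.arg) := by positivity
  have e : ‖1 + z‖ * ‖z‖ * (Real.sin (1 + z).arg * Real.cos z.arg -
    Real.cos (1 + z).arg * Real.sin z.arg) = (‖1 + z‖ * Real.sin (1 + z).arg) *
      (‖z‖ * Real.cos z.arg) - (‖1 + z‖ * Real.cos (1 + z).arg) * (‖z‖ * Real.sin z.arg) := by ring
  rw [e, Complex.norm_mul_sin_arg, Complex.norm_mul_sin_arg, Complex.norm_mul_cos_arg,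
    Complex.norm_mul_cos_arg] at h6
  simp at h6
  linarith

theorem IsUpperRoot.pow_eq {n : ℕ} {z : ℂ} (hz : IsUpperRoot n z) : z ^ n = 1 + z := by
  linear_combination hz.1

/-- Take logarithms of `z ^ n = 1 + z`. The branch index is positive because `n * arg z ≥ arg z >
arg (1 + z)`. -/
theorem IsUpperRoot.exists_arg_eq {n : ℕ} (hn : 1 ≤ n) {z : ℂ} (hz : IsUpperRoot n z) :
    ∃ k : ℤ, 1 ≤ k ∧ n * z.arg = (1 + z).arg + 2 * Real.pi * k ∧
      n * Complex.log z = Complex.log (1 + z) + k * (2 * Real.pi * Complex.I) := by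
  have h0 : z ≠ 0 := by rintro rfl; simpa using hz.2
  have h1 : 1 + z ≠ 0 := by
    intro h
    have := congrArg Complex.im h
    simp at this
    linarith [hz.2]
  have h2 : Complex.exp (n * Complex.log z) = Complex.exp (Complex.log (1 + z)) := by
    rw [Complex.exp_nat_mul, Complex.exp_log h0, Complex.exp_log h1, hz.pow_eq]
  obtain ⟨k, hk⟩ := Complex.exp_eq_exp_iff_exists_int.1 h2
  have h3 : n * z.arg = (1 + z).arg + 2 * Real.pi * k := by
    have := congrArg Complex.im hk
    simp [Complex.log_im] at this
    rw [this]; ring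
  refine ⟨k, ?_, h3, hk⟩
  have h4 := arg_one_add_lt_arg hz.2
  have h5 : z.arg ≤ n * z.arg :=
    le_mul_of_one_le_left (arg_pos_of_im_pos hz.2).1.le (by exact_mod_cast hn)
  have h6 : (0 : ℝ) < k := by
    by_contra! h
    have := mul_nonneg Real.pi_pos.le (neg_nonneg.2 h)
    linarith
  exact_mod_cast h6

/-- The upper root whose argument lies in `(2π / n, 2π / (n - 1))`. -/
def IsPrincipalRoot (n : ℕ) (z : ℂ) : Prop :=
  IsUpperRoot n z ∧ n * z.arg = (1 + z).arg + 2 * Real.pi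

theorem IsUpperRoot.principal_or {n : ℕ} (hn : 1 ≤ n) {z : ℂ} (hz : IsUpperRoot n z) :
    IsPrincipalRoot n z ∨ 4 * Real.pi / n < z.arg := by
  obtain ⟨k, hk, h, -⟩ := hz.exists_arg_eq hn
  rcases hk.eq_or_lt with rfl | hk
  · left; exact ⟨hz, by simpa using h⟩
  · right
    rw [div_lt_iff₀ (by positivity)]
    have h2 : (2 : ℝ) ≤ k := by exact_mod_cast hk
    have := mul_le_mul_of_nonneg_left h2 Real.pi_pos.le
    have h3 := (arg_pos_of_im_pos (z := 1 + z) (by simpa using hz.2)).1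
    linarith

theorem IsPrincipalRoot.two_pi_div_lt_arg {n : ℕ} (hn : 1 ≤ n) {z : ℂ} (hz : IsPrincipalRoot n z) :
    2 * Real.pi / n < z.arg := by
  rw [div_lt_iff₀ (by positivity)]
  linarith [hz.2, (arg_pos_of_im_pos (z := 1 + z) (by simpa using hz.1.2)).1]

theorem IsPrincipalRoot.arg_lt {n : ℕ} (hn : 2 ≤ n) {z : ℂ} (hz : IsPrincipalRoot n z) :
    z.arg < 2 * Real.pi / (n - 1) := by
  have : (2 : ℝ) ≤ n := by exact_mod_cast hn
  rw [lt_div_iff₀ (by linarith)]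
  linarith [hz.2, arg_one_add_lt_arg hz.1.2]

theorem IsPrincipalRoot.arg_lt_pi_div_two {n : ℕ} (hn : 6 ≤ n) {z : ℂ} (hz : IsPrincipalRoot n z) :
    z.arg < Real.pi / 2 := by
  have : (6 : ℝ) ≤ n := by exact_mod_cast hn
  refine (hz.arg_lt (by omega)).trans ?_
  rw [div_lt_iff₀ (by linarith)]
  nlinarith [Real.pi_pos]

theorem IsPrincipalRoot.re_pos {n : ℕ} (hn : 6 ≤ n) {z : ℂ} (hz : IsPrincipalRoot n z) :
    0 < z.re := by
  have h0 : z ≠ 0 := by rintro rfl; simpa using hz.1.2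
  rw [← Complex.norm_mul_cos_arg z]
  have := hz.arg_lt_pi_div_two hn
  have := (arg_pos_of_im_pos hz.1.2).1
  exact mul_pos (norm_pos_iff.2 h0) (Real.cos_pos_of_mem_Ioo ⟨by linarith, by linarith⟩)

theorem IsUpperRoot.norm_pow {n : ℕ} {z : ℂ} (hz : IsUpperRoot n z) : ‖z‖ ^ n = ‖1 + z‖ := by
  rw [← hz.pow_eq, _root_.norm_pow]

/-- In the right half-plane `‖1 + z‖ > 1`, which `‖z‖ ^ n` cannot match when `‖z‖ < 1`. -/
theorem IsUpperRoot.one_le_norm {n : ℕ} {z : ℂ} (hz : IsUpperRoot n z)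
    (hre : 0 ≤ z.re) : 1 ≤ ‖z‖ := by
  by_contra! h
  have h1 : ‖z‖ ^ n ≤ 1 := pow_le_one₀ (norm_nonneg _) h.le
  have h2 := Complex.abs_re_le_norm (1 + z)
  have h3 := Complex.abs_im_le_norm z
  have h4 : (1 : ℝ) ^ 2 < ‖1 + z‖ ^ 2 := by
    rw [Complex.sq_norm, Complex.normSq_apply]
    simp
    nlinarith [hz.2]
  rw [hz.norm_pow] at h1
  nlinarith [norm_nonneg (1 + z)]

theorem IsUpperRoot.norm_le_beta {n : ℕ} (hn : 2 ≤ n) {z : ℂ} (hz : IsUpperRoot n z) {β : ℝ}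
    (hβ : IsBeta n β) : ‖z‖ ≤ β := by
  refine hβ.le_of_pow_le_add_one hn ?_
  rw [hz.norm_pow]
  simpa [add_comm] using norm_add_le (1 : ℂ) z

/-! ### Existence and uniqueness of the principal root by contraction -/

open scoped NNReal

/-- The rectangle containing the logarithm of the principal root. -/
def logRect : Set ℂ := Set.Icc 0 1 ×ℂ Set.Icc 0 (Real.pi / 2)

/-- The map whose fixed points are the logarithms of principal roots. -/
noncomputable def logMap (n : ℕ) (s : ℂ) : ℂ :=
  (Complex.log (1 + Complex.exp s) + 2 * Real.pi * Complex.I) / n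

theorem convex_logRect : Convex ℝ logRect :=
  ((convex_Icc 0 1).linear_preimage Complex.reLm).inter
    ((convex_Icc 0 (Real.pi / 2)).linear_preimage Complex.imLm)

theorem exp_re_im_nonneg_of_mem_logRect {s : ℂ} (hs : s ∈ logRect) :
    0 ≤ (Complex.exp s).re ∧ 0 ≤ (Complex.exp s).im := by
  obtain ⟨-, h1, h2⟩ := hs
  rw [Complex.exp_re, Complex.exp_im]
  exact ⟨mul_nonneg (Real.exp_pos _).le (Real.cos_nonneg_of_mem_Icc ⟨by linarith [Real.pi_pos], h2⟩),
    mul_nonneg (Real.exp_pos _).le (Real.sin_nonneg_of_nonneg_of_le_pi h1 (by linarith [Real.pi_pos]))⟩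

/-- The derivative is `exp s / (1 + exp s) / n`. On the rectangle `exp s` has nonnegative real part,
so the first quotient has norm at most 1; convexity gives the Lipschitz bound. -/
theorem norm_logMap_sub_le {n : ℕ} {s t : ℂ} (hs : s ∈ logRect) (ht : t ∈ logRect) :
    ‖logMap n s - logMap n t‖ ≤ (n : ℝ)⁻¹ * ‖s - t‖ := by
  refine Convex.norm_image_sub_le_of_norm_hasDerivWithin_le (𝕜 := ℂ) (s := logRect)
    (f' := fun s => Complex.exp s / (1 + Complex.exp s) / n) ?_ ?_ convex_logRect ht hs
  · intro x hx
    have h := (exp_re_im_nonneg_of_mem_logRect hx).1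
    refine (HasDerivAt.div_const (HasDerivAt.add_const _ ?_) _).hasDerivWithinAt
    exact ((Complex.hasDerivAt_exp x).const_add 1).clog (.inl (by simp; linarith))
  · intro x hx
    obtain ⟨h1, h2⟩ := exp_re_im_nonneg_of_mem_logRect hx
    have h3 : ‖Complex.exp x‖ ≤ ‖1 + Complex.exp x‖ := by
      rw [Complex.norm_def, Complex.norm_def]
      apply Real.sqrt_le_sqrt
      simp only [Complex.normSq_apply, Complex.add_re, Complex.add_im, Complex.one_re,
        Complex.one_im]
      nlinarith
    simp only [norm_div, Complex.norm_natCast]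
    rw [div_eq_mul_inv]
    refine mul_le_of_le_one_left (by positivity) (div_le_one_of_le₀ h3 (norm_nonneg _))

theorem IsPrincipalRoot.log_mem {n : ℕ} (hn : 6 ≤ n) {z : ℂ} (hz : IsPrincipalRoot n z) :
    Complex.log z ∈ logRect ∧ logMap n (Complex.log z) = Complex.log z := by
  have h0 : z ≠ 0 := by rintro rfl; simpa using hz.1.2
  have hn0 : (n : ℂ) ≠ 0 := by exact_mod_cast (by omega : n ≠ 0)
  have hz1 := hz.1.one_le_norm (hz.re_pos hn).le
  obtain ⟨β, hβ, -⟩ := existsUnique_isBeta (n := n) (by omega)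
  have h2 : (2 : ℝ) ^ 2 ≤ 2 ^ n := pow_le_pow_right₀ (by norm_num) (by omega)
  have hz2 : ‖z‖ ≤ 2 := (hz.1.norm_le_beta (by omega) hβ).trans
    (hβ.le_of_add_one_le_pow (by omega) (by norm_num) (by linarith))
  refine ⟨⟨⟨?_, ?_⟩, ?_, ?_⟩, ?_⟩
  · rw [Complex.log_re]; exact Real.log_nonneg hz1
  · rw [Complex.log_re, Real.log_le_iff_le_exp (by linarith)]
    linarith [Real.exp_one_gt_d9]
  · rw [Complex.log_im]; exact (arg_pos_of_im_pos hz.1.2).1.le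
  · rw [Complex.log_im]; exact (hz.arg_lt_pi_div_two hn).le
  · obtain ⟨k, hk, h1, h2⟩ := hz.1.exists_arg_eq (by omega)
    have hk1 : (k : ℝ) = 1 := by
      have := hz.2
      have : 2 * Real.pi * ((k : ℝ) - 1) = 0 := by linarith
      have := (mul_eq_zero.1 this).resolve_left (by positivity)
      linarith
    have hk1 : k = 1 := by exact_mod_cast hk1
    subst hk1
    rw [logMap, Complex.exp_log h0, div_eq_iff hn0]
    push_cast at h2
    linear_combination -h2

theorem IsPrincipalRoot.eq {n : ℕ} (hn : 6 ≤ n) {z w : ℂ} (hz : IsPrincipalRoot n z)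
    (hw : IsPrincipalRoot n w) : z = w := by
  obtain ⟨h1, h2⟩ := hz.log_mem hn
  obtain ⟨h3, h4⟩ := hw.log_mem hn
  have h := norm_logMap_sub_le (n := n) h1 h3
  rw [h2, h4] at h
  have hn' : (n : ℝ)⁻¹ ≤ 1 / 2 := by
    rw [one_div]; gcongr; exact_mod_cast (by omega : 2 ≤ n)
  have h5 : ‖Complex.log z - Complex.log w‖ = 0 := by
    have := mul_le_mul_of_nonneg_right hn' (norm_nonneg (Complex.log z - Complex.log w))
    linarith [norm_nonneg (Complex.log z - Complex.log w)]
  have hz0 : z ≠ 0 := by rintro rfl; simpa using hz.1.2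
  have hw0 : w ≠ 0 := by rintro rfl; simpa using hw.1.2
  rw [← Complex.exp_log hz0, ← Complex.exp_log hw0, sub_eq_zero.1 (norm_eq_zero.1 h5)]

theorem mapsTo_logMap {n : ℕ} (hn : 6 ≤ n) : Set.MapsTo (logMap n) logRect logRect := by
  intro s hs
  obtain ⟨h1, h2⟩ := exp_re_im_nonneg_of_mem_logRect hs
  have hnR : (6 : ℝ) ≤ n := by exact_mod_cast hn
  have hn0 : (0 : ℝ) < n := by linarith
  have hlo : 1 ≤ ‖1 + Complex.exp s‖ := by
    have := Complex.abs_re_le_norm (1 + Complex.exp s)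
    rw [Complex.add_re, Complex.one_re, abs_of_nonneg (by linarith)] at this
    linarith
  have hhi : ‖1 + Complex.exp s‖ ≤ 4 := by
    refine (norm_add_le _ _).trans ?_
    rw [Complex.norm_exp, norm_one]
    have := Real.exp_le_exp.2 hs.1.2
    linarith [Real.exp_one_lt_d9]
  have ha0 : 0 ≤ (1 + Complex.exp s).arg := Complex.arg_nonneg_iff.2 (by simpa using h2)
  have ha1 : (1 + Complex.exp s).arg ≤ Real.pi / 2 :=
    (abs_le.1 (Complex.abs_arg_le_pi_div_two_iff.2 (by simp; linarith))).2
  have hre : (logMap n s).re = Real.log ‖1 + Complex.exp s‖ / n := by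
    rw [logMap, Complex.div_natCast_re]
    simp [Complex.log_re]
  have him : (logMap n s).im = ((1 + Complex.exp s).arg + 2 * Real.pi) / n := by
    rw [logMap, Complex.div_natCast_im]
    simp [Complex.log_im]
  have hpi := Real.pi_pos
  refine ⟨⟨?_, ?_⟩, ?_, ?_⟩
  · rw [hre]; exact div_nonneg (Real.log_nonneg hlo) hn0.le
  · rw [hre, div_le_one hn0]
    linarith [Real.log_le_sub_one_of_pos (by linarith : 0 < ‖1 + Complex.exp s‖)]
  · rw [him]; positivity
  · rw [him, div_le_iff₀ hn0]
    nlinarith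

theorem exists_isPrincipalRoot {n : ℕ} (hn : 6 ≤ n) : ∃ z, IsPrincipalRoot n z := by
  have hn0 : (n : ℂ) ≠ 0 := by exact_mod_cast (by omega : n ≠ 0)
  have hcl : IsClosed logRect := isClosed_Icc.reProdIm isClosed_Icc
  have hK : ContractingWith ((n : ℝ≥0)⁻¹) ((mapsTo_logMap hn).restrict (logMap n) logRect logRect) := by
    refine ⟨inv_lt_one_of_one_lt₀ (by exact_mod_cast (by omega : 1 < n)), ?_⟩
    refine LipschitzWith.of_dist_le_mul fun x y => ?_
    simpa [Subtype.dist_eq, dist_eq_norm] using norm_logMap_sub_le (n := n) x.2 y.2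
  have h0 : (0 : ℂ) ∈ logRect := by
    refine ⟨⟨?_, ?_⟩, ?_, ?_⟩ <;> simp
    positivity
  obtain ⟨s, hs, hfix, -⟩ := hK.exists_fixedPoint' hcl.isComplete (mapsTo_logMap hn) h0
    (edist_ne_top _ _)
  obtain ⟨h1, h2⟩ := exp_re_im_nonneg_of_mem_logRect hs
  have hfix : Complex.log (1 + Complex.exp s) + 2 * Real.pi * Complex.I = n * s := by
    have := hfix.eq
    rw [logMap, div_eq_iff hn0] at this
    rw [this, mul_comm]
  have hne : 1 + Complex.exp s ≠ 0 := by
    intro h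
    have := congrArg Complex.re h
    simp at this
    linarith
  have him : (1 + Complex.exp s).arg + 2 * Real.pi = n * s.im := by
    simpa [Complex.log_im] using congrArg Complex.im hfix
  have hpi := Real.pi_pos
  have ha0 : 0 ≤ (1 + Complex.exp s).arg := Complex.arg_nonneg_iff.2 (by simpa using h2)
  have hs0 : 0 < s.im := by
    refine lt_of_le_of_ne hs.2.1 fun h => ?_
    rw [← h] at him
    linarith
  refine ⟨Complex.exp s, ⟨?_, ?_⟩, ?_⟩
  · rw [← Complex.exp_nat_mul, ← hfix, Complex.exp_add, Complex.exp_two_pi_mul_I,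
      Complex.exp_log hne]
    ring
  · rw [Complex.exp_im]
    exact mul_pos (Real.exp_pos _) (Real.sin_pos_of_pos_of_lt_pi hs0 (by linarith [hs.2.2]))
  · rw [Complex.arg_exp, (toIocMod_eq_self _).2 ⟨by linarith, by linarith [hs.2.2]⟩, him]

/-! ### Certified approximate roots for `6 ≤ n < 20` -/

open Polynomial in
/-- Near every point there is a root of `p` within `deg p * |p / p'|`. -/
theorem exists_isRoot_norm_sub_le {p : ℂ[X]} (x : ℂ) {η : ℝ} (hη : 0 < η)
    (h : p.natDegree * ‖p.eval x‖ < η * ‖p.derivative.eval x‖) :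
    ∃ z, p.IsRoot z ∧ ‖x - z‖ ≤ η := by
  by_cases hx : p.eval x = 0
  · exact ⟨x, hx, by simpa using hη.le⟩
  by_contra! hall
  have hp0 : p ≠ 0 := by rintro rfl; simp at hx
  -- `p' / p` at `x` is the sum of `1 / (x - z)` over the roots, too small if every root is farther
  -- than `η`.
  have hsum := (IsAlgClosed.splits p).eval_derivative_eq_eval_mul_sum hx
  have hle : ‖(p.roots.map fun z => 1 / (x - z)).sum‖ ≤ p.natDegree * η⁻¹ := by
    refine (norm_multiset_sum_le _).trans ?_
    rw [Multiset.map_map, ← IsAlgClosed.card_roots_eq_natDegree (p := p), ← nsmul_eq_mul]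
    refine (Multiset.sum_le_card_nsmul _ η⁻¹ ?_).trans (by rw [Multiset.card_map])
    intro y hy
    obtain ⟨z, hz, rfl⟩ := Multiset.mem_map.1 hy
    have := hall z ((Polynomial.mem_roots hp0).1 hz)
    simp only [Function.comp, one_div, norm_inv]
    gcongr
  have hn : ‖p.derivative.eval x‖ ≤ ‖p.eval x‖ * (p.natDegree * η⁻¹) := by
    rw [hsum, norm_mul]; gcongr
  have : η * ‖p.derivative.eval x‖ ≤ p.natDegree * ‖p.eval x‖ := by
    calc _ ≤ η * (‖p.eval x‖ * (p.natDegree * η⁻¹)) := by gcongr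
      _ = _ := by field_simp
  linarith

open Polynomial in
theorem exists_root_near {n : ℕ} (hn : 2 ≤ n) (x : ℂ) {η : ℝ} (hη : 0 < η) (hx : 1 ≤ ‖x‖)
    (h : n * ‖x ^ n - x - 1‖ < η * (n - 1)) : ∃ z : ℂ, z ^ n - z - 1 = 0 ∧ ‖x - z‖ ≤ η := by
  have hdeg : (X ^ n - X - 1 : ℂ[X]).natDegree = n := by
    rw [sub_sub]
    have h1 : (X + 1 : ℂ[X]).natDegree = 1 := natDegree_X_add_C 1
    rw [natDegree_sub_eq_left_of_natDegree_lt (by rw [h1, natDegree_X_pow]; omega), natDegree_X_pow]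
  obtain ⟨z, hz, hle⟩ := exists_isRoot_norm_sub_le (p := (X ^ n - X - 1 : ℂ[X])) x hη (by
    rw [hdeg]
    refine lt_of_lt_of_le (by simpa using h) ?_
    gcongr
    simp only [derivative_sub, derivative_X_pow, derivative_X, derivative_one, sub_zero, eval_sub,
      eval_mul, eval_pow, eval_X, eval_one, eval_C]
    refine le_trans ?_ (norm_sub_norm_le _ _)
    rw [norm_mul, norm_pow, norm_one, Complex.norm_natCast]
    have : 1 ≤ ‖x‖ ^ (n - 1) := one_le_pow₀ hx
    have : (n : ℝ) * 1 ≤ n * ‖x‖ ^ (n - 1) := by gcongr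
    linarith)
  exact ⟨z, by simpa [IsRoot] using hz, hle⟩

/-- A non-principal root has argument above `4π / n`, and Jordan's inequality `sin t ≥ 2t / π` then
forces imaginary part above `8 / n`. -/
theorem IsUpperRoot.isPrincipalRoot {n : ℕ} (hn : 1 ≤ n) {z : ℂ} (hz : IsUpperRoot n z)
    (hre : 0 ≤ z.re) (him : z.im * n ≤ 8) : IsPrincipalRoot n z := by
  refine (hz.principal_or hn).resolve_right fun h => ?_
  have hn0 : (0 : ℝ) < n := by positivity
  rw [div_lt_iff₀ hn0] at h
  have h1 := hz.one_le_norm hre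
  have h2 : z.arg ≤ Real.pi / 2 := (abs_le.1 (Complex.abs_arg_le_pi_div_two_iff.2 hre)).2
  have h3 := (arg_pos_of_im_pos hz.2).1
  have h4 := Real.mul_le_sin h3.le h2
  have h5 : Real.sin z.arg ≤ z.im := by
    rw [← Complex.norm_mul_sin_arg z]
    exact le_mul_of_one_le_left
      (Real.sin_nonneg_of_nonneg_of_le_pi h3.le (by linarith [Real.pi_pos])) h1
  have h6 : 2 / Real.pi * (z.arg * n) ≤ 8 := by
    calc 2 / Real.pi * (z.arg * n) = (2 / Real.pi * z.arg) * n := by ring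
      _ ≤ z.im * n := by gcongr; exact h4.trans h5
      _ ≤ 8 := him
  have h7 : 2 / Real.pi * (4 * Real.pi) = 8 := by field_simp; norm_num
  have h8 : 2 / Real.pi * (4 * Real.pi) < 2 / Real.pi * (z.arg * n) := by
    apply mul_lt_mul_of_pos_left h; positivity
  linarith

/-- The real and imaginary parts of `(a + b i) ^ n`. -/
def gaussPow (a b : ℤ) : ℕ → ℤ × ℤ
  | 0 => (1, 0)
  | n + 1 => ((gaussPow a b n).1 * a - (gaussPow a b n).2 * b,
      (gaussPow a b n).1 * b + (gaussPow a b n).2 * a)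

theorem gaussPow_eq (a b : ℤ) (n : ℕ) :
    ((a : ℂ) + b * Complex.I) ^ n = (gaussPow a b n).1 + (gaussPow a b n).2 * Complex.I := by
  induction n with
  | zero => simp [gaussPow]
  | succ n ih =>
    rw [pow_succ, ih, gaussPow]
    push_cast
    linear_combination ((gaussPow a b n).2 : ℂ) * b * Complex.I_sq

/-- The numerators over `Q ^ n` of the parts of `z ^ n - z - 1` at `z = (a + b i) / Q`. -/
def gaussEval (Q a b : ℤ) (n : ℕ) : ℤ × ℤ :=
  ((gaussPow a b n).1 - (a + Q) * Q ^ (n - 1), (gaussPow a b n).2 - b * Q ^ (n - 1))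

theorem gaussEval_eq {Q : ℤ} (hQ : Q ≠ 0) (a b : ℤ) {n : ℕ} (hn : n ≠ 0) :
    (((a : ℂ) + b * Complex.I) / Q) ^ n - ((a : ℂ) + b * Complex.I) / Q - 1 =
      ((gaussEval Q a b n).1 + (gaussEval Q a b n).2 * Complex.I) / Q ^ n := by
  obtain ⟨m, rfl⟩ := Nat.exists_eq_succ_of_ne_zero hn
  have hQ' : (Q : ℂ) ≠ 0 := by exact_mod_cast hQ
  rw [div_pow, gaussPow_eq, gaussEval]
  field_simp
  push_cast
  simp only [Nat.succ_eq_add_one]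
  ring

theorem norm_add_mul_I_sq (x y : ℝ) : ‖(x : ℂ) + y * Complex.I‖ ^ 2 = x ^ 2 + y ^ 2 := by
  rw [Complex.sq_norm, Complex.normSq_add_mul_I]

/-- A root certified by integer arithmetic at `(a + b i) / 10 ^ 5`. -/
theorem IsPrincipalRoot.norm_sub_le_of_gaussEval {n : ℕ} (hn : 6 ≤ n) {z : ℂ}
    (hz : IsPrincipalRoot n z) (a b : ℤ) (hab : 100000 ^ 2 ≤ a ^ 2 + b ^ 2) (ha : 50 ≤ a)
    (hb : 50 < b) (hbn : (b + 50) * n ≤ 800000)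
    (h : (n : ℤ) ^ 2 * ((gaussEval 100000 a b n).1 ^ 2 + (gaussEval 100000 a b n).2 ^ 2) * 2000 ^ 2
      < ((n : ℤ) - 1) ^ 2 * (100000 ^ n) ^ 2) :
    ‖((a : ℂ) + b * Complex.I) / 100000 - z‖ ≤ 1 / 2000 := by
  have hnR : (6 : ℝ) ≤ n := by exact_mod_cast hn
  set x : ℂ := ((a : ℂ) + b * Complex.I) / 100000 with hx
  have hxre : x.re = a / 100000 := by
    rw [hx, show (100000 : ℂ) = ((100000 : ℕ) : ℂ) by norm_num, Complex.div_natCast_re]; simp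
  have hxim : x.im = b / 100000 := by
    rw [hx, show (100000 : ℂ) = ((100000 : ℕ) : ℂ) by norm_num, Complex.div_natCast_im]; simp
  have hx1 : 1 ≤ ‖x‖ := by
    have : (100000 : ℝ) ^ 2 ≤ a ^ 2 + b ^ 2 := by exact_mod_cast hab
    rw [← one_le_sq_iff₀ (norm_nonneg _), Complex.sq_norm, Complex.normSq_apply, hxre, hxim]
    linarith
  obtain ⟨w, hw, hle⟩ := exists_root_near (n := n) (by omega) x (η := 1 / 2000) (by norm_num) hx1 (by
    have e := gaussEval_eq (Q := 100000) (by norm_num) a b (n := n) (by omega)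
    rw [show ((100000 : ℤ) : ℂ) = 100000 by norm_num, ← hx] at e
    rw [e, norm_div, norm_pow, Complex.norm_ofNat, ← mul_div_assoc, div_lt_iff₀ (by positivity)]
    refine lt_of_pow_lt_pow_left₀ 2 (mul_nonneg (mul_nonneg (by norm_num) (by linarith))
      (by positivity)) ?_
    have h' : (n : ℝ) ^ 2 * ((gaussEval 100000 a b n).1 ^ 2 + (gaussEval 100000 a b n).2 ^ 2)
        * 2000 ^ 2 < ((n : ℝ) - 1) ^ 2 * (100000 ^ n) ^ 2 := by exact_mod_cast h
    have hN := norm_add_mul_I_sq (gaussEval 100000 a b n).1 (gaussEval 100000 a b n).2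
    push_cast at hN
    rw [mul_pow, hN]
    linarith)
  have hre := (Complex.abs_re_le_norm (x - w)).trans hle
  have him := (Complex.abs_im_le_norm (x - w)).trans hle
  rw [Complex.sub_re, hxre, abs_le] at hre
  rw [Complex.sub_im, hxim, abs_le] at him
  have haR : (50 : ℝ) ≤ a := by exact_mod_cast ha
  have hbR : (50 : ℝ) < b := by exact_mod_cast hb
  have hbnR : ((b : ℝ) + 50) * n ≤ 800000 := by exact_mod_cast hbn
  -- The margin 50 is the radius `1 / 2000` in units of `10 ^ (-5)`: it keeps `w` in the open first
  -- quadrant with `w.im * n ≤ 8`.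
  have hwu : IsUpperRoot n w := ⟨hw, by linarith⟩
  have hwp : IsPrincipalRoot n w := hwu.isPrincipalRoot (by omega) (by linarith) (by
    have : w.im * n ≤ (b / 100000 + 1 / 2000) * n := by gcongr; linarith
    linarith)
  rwa [hz.eq hn hwp]

/-- The error `24 / n ^ 2` is split: `1 / 2000` for the certified root, the rest for the rational
centre. The slack `1 / 100000` absorbs the decimals used for `log 2` and `2π`. -/
theorem IsPrincipalRoot.norm_sub_le_of_approx {n : ℕ} (hn : 6 ≤ n) {z : ℂ} (a b : ℤ)
    (h : ‖((a : ℂ) + b * Complex.I) / 100000 - z‖ ≤ 1 / 2000)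
    (hn' : n / 2000 ≤ 24 / (n : ℝ) - 1 / 100000)
    (hab : (n * (a / 100000 - 1) - 0.693147) ^ 2 + (n * (b / 100000) - 6.283184) ^ 2
      ≤ (24 / (n : ℝ) - n / 2000 - 1 / 100000) ^ 2) :
    ‖z - (1 + ((Real.log 2 : ℂ) + 2 * (Real.pi : ℂ) * Complex.I) / (n : ℂ))‖
      ≤ 24 / (n : ℝ) ^ 2 := by
  have hn0 : (0 : ℝ) < n := by positivity
  have hnC : (n : ℂ) ≠ 0 := by exact_mod_cast hn0.ne'
  set X : ℝ := n * (a / 100000 - 1) - 0.693147 with hX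
  set Y : ℝ := n * (b / 100000) - 6.283184 with hY
  have h1 : ‖(X : ℂ) + Y * Complex.I‖ ≤ 24 / (n : ℝ) - n / 2000 - 1 / 100000 := by
    refine le_of_sq_le_sq ?_ (by linarith)
    rw [norm_add_mul_I_sq]; exact hab
  have h2 : ‖((0.693147 - Real.log 2 : ℝ) : ℂ)‖ ≤ 1 / 1000000 := by
    rw [Complex.norm_real, Real.norm_eq_abs, abs_le]
    constructor <;> linarith [Real.log_two_gt_d9, Real.log_two_lt_d9]
  have h3 : ‖((6.283184 - 2 * Real.pi : ℝ) : ℂ) * Complex.I‖ ≤ 2 / 1000000 := by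
    rw [norm_mul, Complex.norm_I, mul_one, Complex.norm_real, Real.norm_eq_abs, abs_le]
    constructor <;> linarith [Real.pi_gt_d6, Real.pi_lt_d6]
  have e : z - (1 + ((Real.log 2 : ℂ) + 2 * (Real.pi : ℂ) * Complex.I) / (n : ℂ)) =
      -(((a : ℂ) + b * Complex.I) / 100000 - z) + (((X : ℂ) + Y * Complex.I) +
        (((0.693147 - Real.log 2 : ℝ) : ℂ) + ((6.283184 - 2 * Real.pi : ℝ) : ℂ) * Complex.I)) / n := by
    rw [hX, hY]; push_cast; field_simp; ring
  rw [e]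
  refine (norm_add_le _ _).trans ?_
  rw [norm_neg, norm_div, Complex.norm_natCast]
  have h4 := norm_add_le ((X : ℂ) + Y * Complex.I)
    (((0.693147 - Real.log 2 : ℝ) : ℂ) + ((6.283184 - 2 * Real.pi : ℝ) : ℂ) * Complex.I)
  have h5 := norm_add_le ((0.693147 - Real.log 2 : ℝ) : ℂ)
    (((6.283184 - 2 * Real.pi : ℝ) : ℂ) * Complex.I)
  calc _ ≤ 1 / 2000 + (24 / (n : ℝ) - n / 2000) / n := by gcongr; linarith
    _ = 24 / (n : ℝ) ^ 2 := by field_simp; ring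

theorem IsPrincipalRoot.norm_sub_le_of_lt_twenty {n : ℕ} (hn : 6 ≤ n) (hn20 : n < 20) {z : ℂ}
    (hz : IsPrincipalRoot n z) :
    ‖z - (1 + ((Real.log 2 : ℂ) + 2 * (Real.pi : ℂ) * Complex.I) / (n : ℂ))‖
      ≤ 24 / (n : ℝ) ^ 2 := by
  have key (a b : ℤ) (h1 : 100000 ^ 2 ≤ a ^ 2 + b ^ 2 ∧ 50 ≤ a ∧ 50 < b ∧
      (b + 50) * n ≤ 800000 ∧ (n : ℤ) ^ 2 * ((gaussEval 100000 a b n).1 ^ 2 +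
        (gaussEval 100000 a b n).2 ^ 2) * 2000 ^ 2 < ((n : ℤ) - 1) ^ 2 * (100000 ^ n) ^ 2)
      (h2 : n / 2000 ≤ 24 / (n : ℝ) - 1 / 100000 ∧
        (n * (a / 100000 - 1) - 0.693147) ^ 2 + (n * (b / 100000) - 6.283184) ^ 2
          ≤ (24 / (n : ℝ) - n / 2000 - 1 / 100000) ^ 2) :
      ‖z - (1 + ((Real.log 2 : ℂ) + 2 * (Real.pi : ℂ) * Complex.I) / (n : ℂ))‖
        ≤ 24 / (n : ℝ) ^ 2 := by
    obtain ⟨h11, h12, h13, h14, h15⟩ := h1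
    exact norm_sub_le_of_approx hn a b (hz.norm_sub_le_of_gaussEval hn a b h11 h12 h13 h14 h15)
      h2.1 h2.2
  -- The witnesses approximate `10 ^ 5` times the principal root.
  interval_cases n
  · exact key 45106 100236 (by decide +kernel) (by norm_num)
  · exact key 61709 90086 (by decide +kernel) (by norm_num)
  · exact key 72324 80711 (by decide +kernel) (by norm_num)
  · exact key 79406 72632 (by decide +kernel) (by norm_num)
  · exact key 84315 65789 (by decide +kernel) (by norm_num)
  · exact key 87830 59998 (by decide +kernel) (by norm_num)
  · exact key 90417 55070 (by decide +kernel) (by norm_num)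
  · exact key 92366 50844 (by decide +kernel) (by norm_num)
  · exact key 93863 47191 (by decide +kernel) (by norm_num)
  · exact key 95032 44007 (by decide +kernel) (by norm_num)
  · exact key 95960 41212 (by decide +kernel) (by norm_num)
  · exact key 96705 38742 (by decide +kernel) (by norm_num)
  · exact key 97310 36543 (by decide +kernel) (by norm_num)
  · exact key 97806 34576 (by decide +kernel) (by norm_num)

/-! ### The principal root is the closest to `β` -/

theorem sq_norm_sub_real (z : ℂ) (b : ℝ) :
    ‖z - b‖ ^ 2 = ‖z‖ ^ 2 + b ^ 2 - 2 * b * z.re := by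
  rw [Complex.sq_norm, Complex.sq_norm, Complex.normSq_apply, Complex.normSq_apply]
  simp
  ring

theorem IsUpperRoot.half_le_norm {n : ℕ} (hn : n ≠ 0) {z : ℂ} (hz : IsUpperRoot n z) :
    1 / 2 ≤ ‖z‖ := by
  by_contra! h
  have h1 : ‖z‖ ^ n ≤ ‖z‖ := pow_le_of_le_one (norm_nonneg _) (by linarith) hn
  have h2 := norm_sub_le (1 + z) z
  rw [add_sub_cancel_right, norm_one, ← hz.norm_pow] at h2
  linarith

/-- The distance `β * (8 / n)` separates the two roots: `w` lies at least that far from `β` by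
Jordan's inequality (or by a nonpositive cosine), and `z` lies nearer. -/
theorem IsPrincipalRoot.norm_sub_lt_of_eight_le {n : ℕ} (hn : 8 ≤ n) {β : ℝ} (hβ : IsBeta n β)
    {z w : ℂ} (hz : IsPrincipalRoot n z) (hw : IsUpperRoot n w) (hwarg : 4 * Real.pi / n < w.arg) :
    ‖z - β‖ < ‖w - β‖ := by
  have hnR : (8 : ℝ) ≤ n := by exact_mod_cast hn
  have hn0 : (0 : ℝ) < n := by linarith
  have hβ1 := hβ.1
  have hr1 := hz.1.one_le_norm (hz.re_pos (by omega)).le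
  have hrβ := hz.1.norm_le_beta (by omega) hβ
  obtain ⟨hθ0, -⟩ := arg_pos_of_im_pos hz.1.2
  obtain ⟨hφ0, hφπ⟩ := arg_pos_of_im_pos hw.2
  -- At `n = 8` the coefficients add to `2π * 8/7 + 0.6932 + 0.0834`, just below 8.
  have hθ : z.arg + (β - 1) < 8 / n := by
    have h1 := hz.arg_lt (by omega)
    have h2 := hβ.le_one_add_log_two_div_add hn
    have h3 : 2 * Real.pi / (n - 1) ≤ 6.2832 * (8 / 7) / n := by
      rw [div_le_div_iff₀ (by linarith) hn0]
      have hpi := Real.pi_lt_d6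
      nlinarith
    have h4 : Real.log 2 / n ≤ 0.6932 / n := by
      gcongr; linarith [Real.log_two_lt_d9]
    have h5 : 2 / (3 * (n : ℝ) ^ 2) ≤ 0.0834 / n := by
      rw [div_le_div_iff₀ (by positivity) hn0]
      nlinarith
    have h6 : 6.2832 * (8 / 7) / n + (0.6932 / n + 0.0834 / n) < 8 / (n : ℝ) := by
      rw [← add_div, ← add_div]
      gcongr
      norm_num
    linarith
  have hz2 : ‖z - β‖ ^ 2 < (β * (8 / n)) ^ 2 := by
    have hcos := Real.one_sub_sq_div_two_le_cos (x := z.arg)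
    have h1 : ‖z - β‖ ^ 2 ≤ (β - 1) ^ 2 + (β * z.arg) ^ 2 := by
      rw [sq_norm_sub_real, ← Complex.norm_mul_cos_arg z]
      have h2 : 2 * (‖z‖ * β) * (1 - Real.cos z.arg) ≤ 2 * (β * β) * (z.arg ^ 2 / 2) := by
        gcongr
        · linarith [Real.cos_le_one z.arg]
        · linarith
      have h3 : (β - ‖z‖) ^ 2 ≤ (β - 1) ^ 2 := by gcongr
      nlinarith
    calc ‖z - β‖ ^ 2 ≤ (β - 1) ^ 2 + (β * z.arg) ^ 2 := h1
      _ ≤ (β * (z.arg + (β - 1))) ^ 2 := by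
        have h4 : 0 ≤ (β - 1) * (β * z.arg) := mul_nonneg (by linarith) (by positivity)
        have h5 : (β - 1 + β * z.arg) ^ 2 ≤ (β * (z.arg + (β - 1))) ^ 2 := by
          have : 0 ≤ β - 1 + β * z.arg := add_nonneg (by linarith) (by positivity)
          gcongr
          nlinarith
        nlinarith
      _ < _ := by
        have : 0 ≤ z.arg + (β - 1) := by linarith
        gcongr
  have hw2 : (β * (8 / n)) ^ 2 ≤ ‖w - β‖ ^ 2 := by
    rw [sq_norm_sub_real, ← Complex.norm_mul_cos_arg w]
    rcases le_total w.arg (Real.pi / 2) with h | h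
    · have h1 : 8 / n ≤ Real.sin w.arg := by
        refine le_trans ?_ (Real.mul_le_sin hφ0.le h)
        calc 8 / (n : ℝ) = 2 / Real.pi * (4 * Real.pi / n) := by field_simp; norm_num
          _ ≤ _ := by gcongr
      have h2 : (β * (8 / n)) ^ 2 ≤ (β * Real.sin w.arg) ^ 2 := by gcongr
      nlinarith [Real.sin_sq_add_cos_sq w.arg, sq_nonneg (‖w‖ - β * Real.cos w.arg)]
    · have h1 : Real.cos w.arg ≤ 0 :=
        Real.cos_nonpos_of_pi_div_two_le_of_le h (by linarith [Real.pi_pos])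
      have h2 : (β * (8 / n)) ^ 2 ≤ (β * 1) ^ 2 := by
        gcongr
        rwa [div_le_one hn0]
      have h3 : 0 ≤ ‖w‖ * -Real.cos w.arg := mul_nonneg (norm_nonneg _) (by linarith)
      nlinarith [sq_nonneg ‖w‖]
  exact lt_of_pow_lt_pow_left₀ 2 (norm_nonneg _) (hz2.trans_le hw2)

/-- Here `4π / n > π / 2`, so `w` lies in the left half-plane and the law of cosines with `‖w‖ ≥
1/2` suffices. -/
theorem IsPrincipalRoot.norm_sub_lt_of_lt_eight {n : ℕ} (hn : 6 ≤ n) (hn8 : n < 8) {β : ℝ}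
    (hβ : IsBeta n β) {z w : ℂ} (hz : IsPrincipalRoot n z) (hw : IsUpperRoot n w)
    (hwarg : 4 * Real.pi / n < w.arg) : ‖z - β‖ < ‖w - β‖ := by
  have hβ1 := hβ.1
  have hr1 := hz.1.one_le_norm (hz.re_pos hn).le
  have hrβ := hz.1.norm_le_beta (by omega) hβ
  have hw1 := hw.half_le_norm (by omega)
  obtain ⟨hθ0, -⟩ := arg_pos_of_im_pos hz.1.2
  obtain ⟨hφ0, hφπ⟩ := arg_pos_of_im_pos hw.2
  have hθ := hz.arg_lt (by omega)
  have hpi := Real.pi_lt_d6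
  have hpi0 := Real.pi_pos
  have hcos := Real.one_sub_sq_div_two_le_cos (x := z.arg)
  have hβ2 : β ≤ 1.15 := by
    refine hβ.le_of_add_one_le_pow (by omega) (by norm_num) ?_
    interval_cases n <;> norm_num
  have upper (c : ℝ) (hc : c ≤ Real.cos z.arg) (hc0 : 0 ≤ 1 - 2 * c) :
      ‖z - β‖ ^ 2 ≤ β ^ 2 + (1 - 2 * c) * β ^ 2 := by
    rw [sq_norm_sub_real, ← Complex.norm_mul_cos_arg z]
    have h1 : 2 * (β * ‖z‖) * c ≤ 2 * (β * ‖z‖) * Real.cos z.arg := by gcongr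
    have h2 : (1 - 2 * c) * (β * ‖z‖) ≤ (1 - 2 * c) * (β * β) := by gcongr
    nlinarith
  have lower (c : ℝ) (hc : Real.cos w.arg ≤ -c) (hc0 : 0 ≤ c) :
      β ^ 2 + 1 / 4 + β * c ≤ ‖w - β‖ ^ 2 := by
    rw [sq_norm_sub_real, ← Complex.norm_mul_cos_arg w]
    have h1 : (β * ‖w‖) * c ≤ (β * ‖w‖) * -Real.cos w.arg := by gcongr; linarith
    have h2 : β * (1 / 2) * c ≤ β * ‖w‖ * c := by gcongr
    nlinarith
  refine lt_of_pow_lt_pow_left₀ 2 (norm_nonneg _) ?_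
  interval_cases n
  · have h1 := upper 0.21 (by norm_num at hθ; nlinarith) (by norm_num)
    have h2 : Real.cos w.arg ≤ -(1 / 2) := by
      rw [← Real.cos_pi_div_three, ← Real.cos_pi_sub]
      refine Real.cos_le_cos_of_nonneg_of_le_pi (by linarith) hφπ.le ?_
      norm_num at hwarg
      linarith
    have h3 := lower _ h2 (by norm_num)
    nlinarith
  · have h1 := upper 0.45 (by norm_num at hθ; nlinarith) (by norm_num)
    have h2 : Real.cos w.arg ≤ -0 := by
      rw [neg_zero]
      norm_num at hwarg
      exact Real.cos_nonpos_of_pi_div_two_le_of_le (by linarith) (by linarith)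
    have h3 := lower _ h2 le_rfl
    nlinarith

theorem IsPrincipalRoot.isClosestUpperRoot_iff {n : ℕ} (hn : 6 ≤ n) {β : ℝ} (hβ : IsBeta n β)
    {z : ℂ} (hz : IsPrincipalRoot n z) (w : ℂ) : IsClosestUpperRoot n β w ↔ w = z := by
  have key : ∀ w, IsUpperRoot n w → w ≠ z → ‖z - β‖ < ‖w - β‖ := by
    intro w hw hne
    rcases hw.principal_or (by omega) with h | h
    · exact absurd (h.eq hn hz) hne
    · rcases lt_or_ge n 8 with h8 | h8
      · exact hz.norm_sub_lt_of_lt_eight hn h8 hβ hw h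
      · exact hz.norm_sub_lt_of_eight_le h8 hβ hw h
  constructor
  · intro hw
    by_contra hne
    exact absurd (hw.2 z hz.1) (not_le.2 (key w hw.1 hne))
  · rintro rfl
    refine ⟨hz.1, fun v hv => ?_⟩
    by_cases hne : v = w
    · rw [hne]
    · exact (key v hv hne).le

/-! ### Polar estimates for `n ≥ 20` -/

theorem IsPrincipalRoot.arg_one_add_le {n : ℕ} (hn : 6 ≤ n) {z : ℂ} (hz : IsPrincipalRoot n z)
    (hr : ‖z‖ ≤ 1.0364) (hτ : z.arg ≤ 0.3308) : (1 + z).arg ≤ 0.53 * z.arg := by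
  have hre := hz.re_pos hn
  obtain ⟨hτ0, -⟩ := arg_pos_of_im_pos hz.1.2
  have h1 := (arg_pos_of_im_pos (z := 1 + z) (by simpa using hz.1.2)).1
  have h2 := (arg_one_add_lt_arg hz.1.2).trans (hz.arg_lt_pi_div_two hn)
  refine (Real.le_tan h1.le h2).trans ?_
  rw [Complex.tan_arg, Complex.add_re, Complex.add_im, Complex.one_re, Complex.one_im, zero_add,
    div_le_iff₀ (by linarith), ← Complex.norm_mul_cos_arg z, ← Complex.norm_mul_sin_arg z]
  have hr0 := norm_nonneg z
  calc ‖z‖ * Real.sin z.arg ≤ ‖z‖ * z.arg := by gcongr; exact Real.sin_le hτ0.le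
    _ = (‖z‖ * 1) * z.arg := by ring
    _ ≤ (0.53 * (1 + ‖z‖ * Real.cos z.arg)) * z.arg := by
      refine mul_le_mul_of_nonneg_right ?_ hτ0.le
      have h3 : 0.945 ≤ Real.cos z.arg := by
        nlinarith [Real.one_sub_sq_div_two_le_cos (x := z.arg)]
      have h4 : ‖z‖ * 0.945 ≤ ‖z‖ * Real.cos z.arg := by gcongr
      nlinarith
    _ = _ := by ring

/-- The modulus is bounded by `β`. The crude bound `2π / 19 < 0.3308` on the argument gives `arg (1
+ z) ≤ 0.53 * arg z`, which fed back into `n * arg z = arg (1 + z) + 2π` sharpens it. The other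
decimals round up values at `n = 20`. -/
theorem IsPrincipalRoot.polar_bounds {n : ℕ} (hn : 20 ≤ n) {z : ℂ} (hz : IsPrincipalRoot n z) :
    ‖z‖ ≤ 1 + Real.log 2 * (n : ℝ)⁻¹ + 2 / 3 * (n : ℝ)⁻¹ ^ 2 ∧
    ‖z‖ ≤ 1 + 0.7266 * (n : ℝ)⁻¹ ∧
    2 * Real.pi * (n : ℝ)⁻¹ < z.arg ∧
    z.arg ≤ 2 * Real.pi * (1 + 0.545 * (n : ℝ)⁻¹) * (n : ℝ)⁻¹ ∧
    z.arg ≤ 0.3308 ∧ z.arg ^ 2 ≤ 41.67 * (n : ℝ)⁻¹ ^ 2 := by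
  obtain ⟨β, hβ, -⟩ := existsUnique_isBeta (n := n) (by omega)
  have hnR : (20 : ℝ) ≤ n := by exact_mod_cast hn
  have hn0 : (0 : ℝ) < n := by linarith
  have hrβ := (hz.1.norm_le_beta (by omega) hβ).trans (hβ.le_one_add_log_two_div_add (by omega))
  have hτ0 := (arg_pos_of_im_pos hz.1.2).1
  have hpi := Real.pi_lt_d6
  have hpi0 := Real.pi_pos
  have hL := Real.log_two_lt_d9
  have hτlt : z.arg < 0.3308 := by
    refine (hz.arg_lt (by omega)).trans ?_
    rw [div_lt_iff₀ (by linarith)]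
    linarith
  have hTlo := hz.two_pi_div_lt_arg (by omega)
  rw [div_eq_mul_inv] at hTlo
  have e1 : 1 + Real.log 2 / n + 2 / (3 * (n : ℝ) ^ 2) =
      1 + Real.log 2 * (n : ℝ)⁻¹ + 2 / 3 * (n : ℝ)⁻¹ ^ 2 := by field_simp
  rw [e1] at hrβ
  have hm0 : 0 < (n : ℝ)⁻¹ := by positivity
  have hnm : n * (n : ℝ)⁻¹ = 1 := mul_inv_cancel₀ hn0.ne'
  have hm20 : (n : ℝ)⁻¹ ≤ 1 / 20 := by
    rw [← one_div]; gcongr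
  have harg := hz.2
  generalize (n : ℝ)⁻¹ = m at *
  have hrm' : ‖z‖ ≤ 1 + 0.7266 * m := by nlinarith
  have hφ := hz.arg_one_add_le (by omega) (by linarith) hτlt.le
  generalize z.arg = τ at *
  have hτm : τ ≤ 2 * Real.pi * (1 + 0.545 * m) * m := by
    have h1 : n * τ ≤ 2 * Real.pi + 0.53 * τ := by linarith
    have h2 : τ * (1 - 0.53 * m) ≤ 2 * Real.pi * m := by
      have := mul_le_mul_of_nonneg_left h1 hm0.le
      have e : m * (n * τ) = τ := by rw [← mul_assoc, mul_comm m, hnm, one_mul]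
      linarith
    have h3 : 1 ≤ (1 + 0.545 * m) * (1 - 0.53 * m) := by nlinarith
    have h4 : 0 < 1 - 0.53 * m := by linarith
    refine le_of_mul_le_mul_right (h2.trans ?_) h4
    have := mul_le_mul_of_nonneg_left h3 (by positivity : 0 ≤ 2 * Real.pi * m)
    linarith
  have hτm' : τ ≤ 6.455 * m := by
    refine hτm.trans (mul_le_mul_of_nonneg_right ?_ hm0.le)
    nlinarith
  refine ⟨hrβ, hrm', hTlo, hτm, hτlt.le, ?_⟩
  calc τ ^ 2 ≤ (6.455 * m) ^ 2 := by gcongr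
    _ ≤ _ := by rw [mul_pow]; exact mul_le_mul_of_nonneg_right (by norm_num) (sq_nonneg m)

theorem IsPrincipalRoot.abs_im_sub_le {n : ℕ} (hn : 20 ≤ n) {z : ℂ} (hz : IsPrincipalRoot n z) :
    |z.im - 2 * Real.pi * (n : ℝ)⁻¹| ≤ 8.2 * (n : ℝ)⁻¹ ^ 2 := by
  have hnR : (20 : ℝ) ≤ n := by exact_mod_cast hn
  have hr1 := hz.1.one_le_norm (hz.re_pos (by omega)).le
  obtain ⟨-, hr, hTlo, hτm, hτlt, hτ2⟩ := hz.polar_bounds hn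
  obtain ⟨hτ0, hτπ⟩ := arg_pos_of_im_pos hz.1.2
  have hpi := Real.pi_lt_d6
  have hpi0 := Real.pi_pos
  have hm0 : 0 < (n : ℝ)⁻¹ := by positivity
  have hm20 : (n : ℝ)⁻¹ ≤ 1 / 20 := by
    rw [← one_div]; gcongr
  have hsin0 : 0 ≤ Real.sin z.arg := Real.sin_nonneg_of_nonneg_of_le_pi hτ0.le hτπ.le
  rw [← Complex.norm_mul_sin_arg z]
  generalize (n : ℝ)⁻¹ = m at *
  generalize z.arg = τ at *
  generalize ‖z‖ = r at *
  rw [abs_le]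
  constructor
  · have h1 := Real.sin_gt_sub_cube hτ0
    have h2 : Real.sin τ ≤ r * Real.sin τ := le_mul_of_one_le_left hsin0 hr1
    have h3 : τ ^ 3 ≤ 0.3308 * (41.67 * m ^ 2) := by
      rw [pow_succ']; gcongr
    linarith [sq_nonneg m]
  · have h1 : r * Real.sin τ ≤ (1 + 0.7266 * m) * (2 * Real.pi * (1 + 0.545 * m) * m) := by
      gcongr
      exact (Real.sin_le hτ0.le).trans hτm
    have h2 : (1 + 0.7266 * m) * (1 + 0.545 * m) ≤ 1 + 1.292 * m := by nlinarith
    have h3 := mul_le_mul_of_nonneg_left h2 (by positivity : 0 ≤ 2 * Real.pi * m)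
    have h4 : Real.pi * m ^ 2 ≤ 3.1416 * m ^ 2 :=
      mul_le_mul_of_nonneg_right (by linarith) (sq_nonneg m)
    linarith

/-- Above, the real part is at most `‖z‖`. Below, `n * (‖z‖ - 1) ≥ log ‖1 + z‖`, and `‖1 + z‖` is
nearly 2; most of the loss is the cosine term `‖z‖ * τ ^ 2 / 2`. -/
theorem IsPrincipalRoot.abs_re_sub_le {n : ℕ} (hn : 20 ≤ n) {z : ℂ} (hz : IsPrincipalRoot n z) :
    |z.re - 1 - Real.log 2 * (n : ℝ)⁻¹| ≤ 22.2 * (n : ℝ)⁻¹ ^ 2 := by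
  have hnR : (20 : ℝ) ≤ n := by exact_mod_cast hn
  have hn0 : (0 : ℝ) < n := by linarith
  have hr1 := hz.1.one_le_norm (hz.re_pos (by omega)).le
  obtain ⟨hr, hr', -, -, hτlt, hτ2⟩ := hz.polar_bounds hn
  have hcos := Real.one_sub_sq_div_two_le_cos (x := z.arg)
  have hτ0 := (arg_pos_of_im_pos hz.1.2).1
  have hm0 : 0 < (n : ℝ)⁻¹ := by positivity
  have hnm : n * (n : ℝ)⁻¹ = 1 := mul_inv_cancel₀ hn0.ne'
  have hm20 : (n : ℝ)⁻¹ ≤ 1 / 20 := by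
    rw [← one_div]; gcongr
  have hlog : n * Real.log ‖z‖ = Real.log ‖1 + z‖ := by
    rw [← hz.1.norm_pow, Real.log_pow]
  have hre1 : 1 + ‖z‖ * Real.cos z.arg ≤ ‖1 + z‖ := by
    rw [Complex.norm_mul_cos_arg]
    simpa using Complex.re_le_norm (1 + z)
  rw [← Complex.norm_mul_cos_arg z]
  have hcos1 := Real.cos_le_one z.arg
  generalize (n : ℝ)⁻¹ = m at *
  generalize z.arg = τ at *
  generalize ‖z‖ = r at *
  generalize ‖1 + z‖ = R at *
  have hq : τ ^ 2 ≤ 0.11 := by nlinarith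
  rw [abs_le]
  constructor
  · have h1 : 2 * (1 - τ ^ 2 / 4) ≤ R := by
      have := mul_le_mul_of_nonneg_right hr1 (by linarith : 0 ≤ Real.cos τ)
      linarith
    have hq0 : 0 < 1 - τ ^ 2 / 4 := by linarith
    have h2 : Real.log 2 - 1.03 * (τ ^ 2 / 4) ≤ Real.log R := by
      refine le_trans ?_ (Real.log_le_log (by linarith) h1)
      rw [Real.log_mul (by norm_num) hq0.ne']
      have h3 := Real.one_sub_inv_le_log_of_pos hq0
      have h4 : (1 - τ ^ 2 / 4)⁻¹ ≤ 1 + 1.03 * (τ ^ 2 / 4) := by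
        rw [inv_le_iff_one_le_mul₀ hq0]
        generalize τ ^ 2 = t at *
        have : 0 ≤ t := by linarith
        nlinarith
      linarith
    have h3 : Real.log R ≤ n * (r - 1) := by
      rw [← hlog]
      exact mul_le_mul_of_nonneg_left (Real.log_le_sub_one_of_pos (by linarith)) hn0.le
    have h4 : Real.log 2 * m - 1.03 * (τ ^ 2 / 4) * m ≤ r - 1 := by
      have := mul_le_mul_of_nonneg_right (h2.trans h3) hm0.le
      have e : n * (r - 1) * m = r - 1 := by rw [mul_right_comm, hnm, one_mul]
      linarith
    have h5 : τ ^ 2 * m ≤ 41.67 * m ^ 2 * (1 / 20) := by gcongr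
    have h6 : r * (1 - τ ^ 2 / 2) ≤ r * Real.cos τ :=
      mul_le_mul_of_nonneg_left hcos (by linarith)
    have h7 : r * τ ^ 2 ≤ 1.0364 * (41.67 * m ^ 2) :=
      mul_le_mul (by linarith) hτ2 (sq_nonneg τ) (by norm_num)
    linarith [sq_nonneg m]
  · have := mul_le_mul_of_nonneg_left hcos1 (by linarith : 0 ≤ r)
    linarith [sq_nonneg m]

theorem IsPrincipalRoot.norm_sub_le_of_twenty_le {n : ℕ} (hn : 20 ≤ n) {z : ℂ}
    (hz : IsPrincipalRoot n z) :
    ‖z - (1 + ((Real.log 2 : ℂ) + 2 * (Real.pi : ℂ) * Complex.I) / (n : ℂ))‖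
      ≤ 24 / (n : ℝ) ^ 2 := by
  have e1 : z - (1 + ((Real.log 2 : ℂ) + 2 * (Real.pi : ℂ) * Complex.I) / (n : ℂ)) =
      ((z.re - 1 - Real.log 2 * (n : ℝ)⁻¹ : ℝ) : ℂ) +
        ((z.im - 2 * Real.pi * (n : ℝ)⁻¹ : ℝ) : ℂ) * Complex.I := by
    conv_lhs => rw [← Complex.re_add_im z]
    push_cast
    ring
  have e2 : 24 / (n : ℝ) ^ 2 = 24 * (n : ℝ)⁻¹ ^ 2 := by rw [inv_pow, div_eq_mul_inv]
  rw [e1, e2]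
  refine le_of_sq_le_sq ?_ (by positivity)
  rw [norm_add_mul_I_sq]
  have h1 := sq_le_sq' (abs_le.1 (hz.abs_re_sub_le hn)).1 (abs_le.1 (hz.abs_re_sub_le hn)).2
  have h2 := sq_le_sq' (abs_le.1 (hz.abs_im_sub_le hn)).1 (abs_le.1 (hz.abs_im_sub_le hn)).2
  rw [mul_pow] at h1 h2 ⊢
  -- `22.2 ^ 2 + 8.2 ^ 2 < 24 ^ 2`.
  linarith [sq_nonneg ((n : ℝ)⁻¹ ^ 2)]

theorem mainTheorem4 :
    (∀ n : ℕ, 2 ≤ n → ∃! β : ℝ, IsBeta n β) ∧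
    (∀ n : ℕ, 8 ≤ n → ∀ β : ℝ, IsBeta n β →
      |β - (1 + Real.log 2 / (n : ℝ))| ≤ 2 / (3 * (n : ℝ) ^ 2)) ∧
    (∀ n : ℕ, 6 ≤ n → ∀ β : ℝ, IsBeta n β →
      (∃! γ : ℂ, IsClosestUpperRoot n β γ) ∧
      ∀ γ : ℂ, IsClosestUpperRoot n β γ →
        ‖γ - (1 + ((Real.log 2 : ℂ) + 2 * (Real.pi : ℂ) * Complex.I) / (n : ℂ))‖
          ≤ 24 / (n : ℝ) ^ 2) := by
  refine ⟨fun n hn => existsUnique_isBeta hn, fun n hn β hβ => ?_, fun n hn β hβ => ?_⟩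
  · have h1 := hβ.one_add_log_two_div_le (by omega)
    have h2 := hβ.le_one_add_log_two_div_add hn
    rw [abs_of_nonneg (by linarith)]
    linarith
  · obtain ⟨z, hz⟩ := exists_isPrincipalRoot hn
    have hiff := hz.isClosestUpperRoot_iff hn hβ
    refine ⟨⟨z, (hiff z).2 rfl, fun w hw => (hiff w).1 hw⟩, fun γ hγ => ?_⟩
    rw [(hiff γ).1 hγ]
    rcases lt_or_ge n 20 with h | h
    · exact hz.norm_sub_le_of_lt_twenty hn h
    · exact hz.norm_sub_le_of_twenty_le h
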